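/- Fix an integer $N\ge 1$, a strike $k>0$ and integers $j_0<j^*<j_L$, and consider one of the following two models. (BM) $\beta>0$, grid points $x_j=j/\sqrt N$, $\pi=\tfrac12$, $c=\cosh(\beta/\sqrt N)$, $\bar h_{j,t}=e^{\beta x_j}c^{-t}$. (GBM) $\beta>1$, grid points $x_j=e^{j/\sqrt N}$, $\pi=1/(1+e^{1/\sqrt N})$, $c=\pi e^{\beta/\sqrt N}+(1-\pi)e^{-\beta/\sqrt N}$, $\bar h_{j,t}=x_j^{\beta}c^{-t}$. Let $Y$ be the walk on the indices $j$ started at $j^*$ that steps up with probability $\pi$ and down with probability $1-\pi$, so that $x_{Y_t}$ and $\bar h_{Y_t,t}$ are martingales. Let $\bar F_{j,t}=(\bar h_{j,t}-k)_+$ be the discretised LETF payoff, and let $K_j=\log(\bar h_{j,0}/k)/\log c$ be the real time at which $\bar h_{j,\cdot}$ equals $k$. Let $\mu^N$ be a probability measure on $\{x_j: j_0\le j\le j_L\}$ and put, for $j_0<j<j_L$, $$U_j=\frac{\sum_{i=j_0}^{j_L}|x_i-x_j|\,\mu^N(\{x_i\})-|x_{j^*}-x_j|}{\pi(x_{j+1}-x_j)+(1-\pi)(x_j-x_{j-1})};$$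 the denominator is $1/\sqrt N$ in the model (BM). The linear programme $\mathcal P^N$ is to maximise $\sum_{t\ge1}\sum_{j=j_0}^{j_L}\bar F_{j,t}\,q_{j,t}$ over the families $(p_{j,t})$, $j_0<j<j_L$, $t\ge1$, in $\ell^1$, where $p_{j,0}=\mathbf 1\{j=j^*\}$, $p_{j,t}=0$ for $j\notin(j_0,j_L)$, and $$q_{j,t}=\pi p_{j-1,t-1}+(1-\pi)p_{j+1,t-1}-p_{j,t}\qquad(t\ge1),$$ subject to $p_{j,t}\ge0$, $q_{j,t}\ge0$ and $\sum_{t\ge0}p_{j,t}\le U_j$ for all $j_0<j<j_L$. (Here $p_{j,t}$ and $q_{j,t}$ are the masses that continue from, respectively are stopped at, $(j,t)$.) Theorem. If $\mathcal P^N$ is feasible, then it has an optimal solution $(p^*,q^*)$ with the discrete $K$-cave property: for all $j_0\le i\le j_L$ and all integers $t\ge1$, (i) if $q^*_{i,t}>0$ and $t<K_i$, then $p^*_{i,s}=0$ for all $1\le s<t$; (ii) if $q^*_{i,t}>0$ and $t>K_i$, then $p^*_{i,s}=0$ for all $s>t$. -/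

import Mathlib

namespace LETF

/-- The two versions of the problem: the price process is a Brownian motion with payoff
`(exp (β x - β² t / 2) - k)₊`, or a geometric Brownian motion with payoff
`(x ^ β * exp (-β (β - 1) t / 2) - k)₊`. -/
inductive Model
  | brownian
  | geometric

/-- The leverage parameter must exceed this bound: `β > 0` for Brownian motion, `β > 1` for
geometric Brownian motion. -/
def Model.minLeverage : Model → ℝ
  | .brownian => 0
  | .geometric => 1

/-- The data of the discretised problem: the space grid has indices `jLo, …, jHi` and mesh
`1 / √N`, the walk starts at index `jStar`, and `μ j` is the mass that the discretised target
distribution gives to the grid point with index `j`. -/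
structure Problem where
  model : Model
  N : ℕ
  β : ℝ
  k : ℝ
  jLo : ℤ
  jHi : ℤ
  jStar : ℤ
  μ : ℤ → ℝ

/-- Standing assumptions on the data. -/
structure Problem.Admissible (P : Problem) : Prop where
  N_pos : 0 < P.N
  leverage : P.model.minLeverage < P.β
  strike_pos : 0 < P.k
  lo_lt : P.jLo < P.jStar
  lt_hi : P.jStar < P.jHi
  μ_nonneg : ∀ j, 0 ≤ P.μ j
  μ_sum : ∑ j ∈ Finset.Icc P.jLo P.jHi, P.μ j = 1

noncomputable section

namespace Problem

variable (P : Problem)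

/-- The grid point `x_j`. -/
def x (j : ℤ) : ℝ :=
  match P.model with
  | .brownian => j / √(P.N : ℝ)
  | .geometric => Real.exp (j / √(P.N : ℝ))

/-- Probability that the walk steps from `j` to `j + 1` (it steps to `j - 1` otherwise). In the
geometric case this is the value for which the walk on the points `x_j` is a martingale. -/
def up : ℝ :=
  match P.model with
  | .brownian => 1 / 2
  | .geometric => 1 / (1 + Real.exp (1 / √(P.N : ℝ)))

/-- The factor by which one step of the walk multiplies the conditional mean of
`exp (β x)` (Brownian case), respectively `x ^ β` (geometric case). -/
def growth : ℝ :=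
  match P.model with
  | .brownian => Real.cosh (P.β / √(P.N : ℝ))
  | .geometric =>
      P.up * Real.exp (P.β / √(P.N : ℝ)) + (1 - P.up) * Real.exp (-(P.β / √(P.N : ℝ)))

/-- The value at step `0` of the discretised exponential martingale. -/
def hInit (j : ℤ) : ℝ :=
  match P.model with
  | .brownian => Real.exp (P.β * P.x j)
  | .geometric => P.x j ^ P.β

/-- The discretised martingale term, with the number of steps `t` allowed to be real. -/
def h (j : ℤ) (t : ℝ) : ℝ := P.hInit j * P.growth ^ (-t)

/-- The discretised payoff after `t` steps. -/
def F (j : ℤ) (t : ℕ) : ℝ := max (P.h j t - P.k) 0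

/-- The separating curve in units of steps: the time at which `h j` takes the value `k`. -/
def K (j : ℤ) : ℝ := Real.log (P.hInit j / P.k) / Real.log P.growth

/-- Inverse of the mean absolute increment `E |x_{j ± 1} - x_j|` of the walk at `x_j`. -/
def invStep (j : ℤ) : ℝ :=
  match P.model with
  | .brownian => √(P.N : ℝ)
  | .geometric => 1 / (P.up * (P.x (j + 1) - P.x j) + (1 - P.up) * (P.x j - P.x (j - 1)))

/-- The bound on the expected number of steps taken from `j`. -/
def U (j : ℤ) : ℝ :=
  P.invStep j *
    (∑ i ∈ Finset.Icc P.jLo P.jHi, |P.x i - P.x j| * P.μ i - |P.x P.jStar - P.x j|)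

/-- The mass `q_{j,t}` stopped at `(j, t)`, given the masses `p_{j,t}` that continue from
`(j, t)`. -/
def q (p : ℤ → ℕ → ℝ) (j : ℤ) : ℕ → ℝ
  | 0 => 0
  | t + 1 => P.up * p (j - 1) t + (1 - P.up) * p (j + 1) t - p j (t + 1)

/-- The constraints of the linear programme. The variables are `p j t` with `t ≥ 1` and `j`
strictly between `jLo` and `jHi`; the other values are fixed, `p j 0` being the initial mass and
`p j t` being zero at the absorbing end points and outside the grid. -/
structure Feasible (p : ℤ → ℕ → ℝ) : Prop where
  init : ∀ j, p j 0 = if j = P.jStar then 1 else 0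
  absorbed : ∀ j, j ∉ Set.Ioo P.jLo P.jHi → ∀ t, p j t = 0
  summable : Summable fun z : ℤ × ℕ => p z.1 z.2
  nonneg : ∀ j t, 0 ≤ p j t
  local_time : ∀ j ∈ Set.Ioo P.jLo P.jHi, ∑' t, p j t ≤ P.U j
  stopped_nonneg : ∀ j ∈ Set.Ioo P.jLo P.jHi, ∀ t, 0 ≤ P.q p j t

/-- The objective, i.e. the expected payoff at the stopping time. -/
def objective (p : ℤ → ℕ → ℝ) : ℝ :=
  ∑' t : ℕ, ∑ j ∈ Finset.Icc P.jLo P.jHi, P.F j (t + 1) * P.q p j (t + 1)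

/-- `p` is an optimal solution of the linear programme. -/
def Optimal (p : ℤ → ℕ → ℝ) : Prop :=
  P.Feasible p ∧ ∀ p', P.Feasible p' → P.objective p' ≤ P.objective p

end Problem

end

end LETF

namespace LETF.Problem

open Filter Topology

variable {P : Problem}

/-! The feasible set is compact for pointwise convergence, and the objective and a secondary
objective with weight `tieBreak` are continuous on it. So some `p` maximises the first and, among
its maximisers, the second (`exists_lexMax`).

Suppose mass stops at `(i, t)` while mass continues from `(i, s)`. Swapping a little of each
(`Feasible.exchange`) moves a subflow in time only, so the sums over time, and with them the local
time bounds, are preserved. The value of `f` changes by that of `f j (t + r) - f j (s + r)`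
collected where the subflow stops, minus the same difference at its start.

If `s < t < K i`, the payoff difference dominates the martingale `h j (t + r) - h j (s + r)`,
because `y ↦ (y - k)₊` is 1-Lipschitz and `h` decreases in time. If `K i < t < s`, it dominates `0`.
Both bounds are equalities at the start, so by optional stopping (`value_of_harmonic`) the swap
loses nothing, and optimality forces equality wherever the subflow stops. There `tieBreak` compares
squares of times in the first case and, at worst, terms `-(1 / 2) ^ t` in the second; either way the
swap strictly improves the secondary objective, which `Feasible.gain_le_of_lexMax` excludes. -/

/-! ### The walk and its exponential martingale. -/

theorem Admissible.mesh_pos (hP : P.Admissible) : 0 < √(P.N : ℝ) :=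
  Real.sqrt_pos.2 (Nat.cast_pos.2 hP.N_pos)

theorem up_pos (P : Problem) : 0 < P.up := by
  unfold up
  split
  · norm_num
  · positivity

theorem up_lt_one (P : Problem) : P.up < 1 := by
  unfold up
  split
  · norm_num
  · rw [div_lt_one (by positivity)]
    linarith [Real.exp_pos (1 / √(P.N : ℝ))]

theorem one_lt_growth (hP : P.Admissible) : 1 < P.growth := by
  have hN := hP.mesh_pos
  have hl := hP.leverage
  unfold growth up
  unfold Model.minLeverage at hl
  split <;> rename_i hm <;> simp only [hm] at hl ⊢
  · exact Real.one_lt_cosh.2 (div_pos hl hN).ne'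
  · set a := Real.exp (1 / √(P.N : ℝ)) with ha
    set b := Real.exp (P.β / √(P.N : ℝ)) with hb
    have hab : a < b := Real.exp_lt_exp.2 (div_lt_div_of_pos_right hl hN)
    have h1a : 1 < a := Real.one_lt_exp_iff.2 (by positivity)
    have hb0 : 0 < b := by linarith
    rw [Real.exp_neg, ← hb]
    -- The factor `b - a` is where `β > 1` enters.
    have : 1 / (1 + a) * b + (1 - 1 / (1 + a)) * b⁻¹ - 1 = (b - a) * (b - 1) / ((1 + a) * b) := by
      field_simp
      ring
    have : 0 < (b - a) * (b - 1) / ((1 + a) * b) :=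
      div_pos (mul_pos (by linarith) (by linarith)) (by positivity)
    linarith

theorem hInit_pos (P : Problem) (j : ℤ) : 0 < P.hInit j := by
  unfold hInit x
  split
  · positivity
  · exact Real.rpow_pos_of_pos (Real.exp_pos _) _

theorem hInit_add_one (P : Problem) (j : ℤ) :
    P.hInit (j + 1) = P.hInit j * Real.exp (P.β / √(P.N : ℝ)) := by
  unfold hInit x
  cases P.model
  · simp only
    rw [← Real.exp_add]
    push_cast
    congr 1
    ring
  · simp only
    rw [← Real.exp_mul, ← Real.exp_mul, ← Real.exp_add]
    push_cast
    congr 1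
    ring

theorem hInit_sub_one (P : Problem) (j : ℤ) :
    P.hInit (j - 1) = P.hInit j * Real.exp (-(P.β / √(P.N : ℝ))) := by
  have := P.hInit_add_one (j - 1)
  rw [sub_add_cancel] at this
  rw [this, mul_assoc, ← Real.exp_add, add_neg_cancel, Real.exp_zero, mul_one]

theorem hInit_harmonic (P : Problem) (j : ℤ) :
    P.up * P.hInit (j + 1) + (1 - P.up) * P.hInit (j - 1) = P.growth * P.hInit j := by
  rw [hInit_add_one, hInit_sub_one]
  unfold growth
  rcases hm : P.model
  · have : P.up = 1 / 2 := by simp [up, hm]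
    simp only [this, Real.cosh_eq]
    ring
  · simp only
    ring

theorem h_natCast (hP : P.Admissible) (j : ℤ) (t : ℕ) : P.h j t = P.hInit j * P.growth⁻¹ ^ t := by
  have := one_lt_growth hP
  rw [h, Real.rpow_neg (by linarith), Real.rpow_natCast, inv_pow]

theorem h_pos (hP : P.Admissible) (j : ℤ) (t : ℕ) : 0 < P.h j t := by
  have := one_lt_growth hP
  rw [h_natCast hP]
  exact mul_pos (P.hInit_pos j) (by positivity)

theorem h_harmonic (hP : P.Admissible) (j : ℤ) (t : ℕ) :
    P.h j t = P.up * P.h (j + 1) (t + 1 : ℕ) + (1 - P.up) * P.h (j - 1) (t + 1 : ℕ) := by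
  have h1 := one_lt_growth hP
  have h2 := P.hInit_harmonic j
  rw [h_natCast hP, h_natCast hP, h_natCast hP, pow_succ]
  have : P.up * (P.hInit (j + 1) * (P.growth⁻¹ ^ t * P.growth⁻¹)) +
      (1 - P.up) * (P.hInit (j - 1) * (P.growth⁻¹ ^ t * P.growth⁻¹)) =
      (P.up * P.hInit (j + 1) + (1 - P.up) * P.hInit (j - 1)) *
        (P.growth⁻¹ ^ t * P.growth⁻¹) := by ring
  rw [this, h2]
  field_simp

theorem h_strictAnti (hP : P.Admissible) (j : ℤ) : StrictAnti fun t : ℕ => P.h j t := by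
  have h1 := one_lt_growth hP
  intro s t hst
  simp only [h_natCast hP]
  exact mul_lt_mul_of_pos_left
    (pow_lt_pow_right_of_lt_one₀ (by positivity) (inv_lt_one_of_one_lt₀ h1) hst) (P.hInit_pos j)

theorem lt_h_iff (hP : P.Admissible) (j : ℤ) (t : ℕ) : P.k < P.h j t ↔ (t : ℝ) < P.K j := by
  have h1 := one_lt_growth hP
  have hk := hP.strike_pos
  have h0 := P.hInit_pos j
  rw [K, lt_div_iff₀ (Real.log_pos h1), ← Real.log_pow,
    Real.log_lt_log_iff (by positivity) (by positivity), lt_div_iff₀ hk, h_natCast hP, inv_pow,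
    ← div_eq_mul_inv, lt_div_iff₀ (by positivity), mul_comm]

theorem h_lt_iff (hP : P.Admissible) (j : ℤ) (t : ℕ) : P.h j t < P.k ↔ P.K j < (t : ℝ) := by
  have h1 := one_lt_growth hP
  have hk := hP.strike_pos
  have h0 := P.hInit_pos j
  rw [K, div_lt_iff₀ (Real.log_pos h1), ← Real.log_pow,
    Real.log_lt_log_iff (by positivity) (by positivity), div_lt_iff₀ hk, h_natCast hP, inv_pow,
    ← div_eq_mul_inv, div_lt_iff₀ (by positivity), mul_comm]

/-! ### Values of general payoffs and optional stopping. -/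

/-- The payoff of stopping according to `p`, for the payoff function `f`. -/
noncomputable def value (P : Problem) (f : ℤ → ℕ → ℝ) (p : ℤ → ℕ → ℝ) : ℝ :=
  ∑' t : ℕ, ∑ j ∈ Finset.Icc P.jLo P.jHi, f j (t + 1) * P.q p j (t + 1)

/-- Boundedness on the grid. -/
def Bdd (P : Problem) (f : ℤ → ℕ → ℝ) : Prop :=
  ∃ C, ∀ j ∈ Finset.Icc P.jLo P.jHi, ∀ t, |f j t| ≤ C

theorem Bdd.comp_add {f : ℤ → ℕ → ℝ} (hf : P.Bdd f) (s : ℕ) : P.Bdd fun j r => f j (s + r) :=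
  hf.imp fun _ hC j hj t => hC j hj (s + t)

theorem Bdd.sub {f g : ℤ → ℕ → ℝ} (hf : P.Bdd f) (hg : P.Bdd g) :
    P.Bdd fun j r => f j r - g j r := by
  obtain ⟨C, hC⟩ := hf
  obtain ⟨D, hD⟩ := hg
  exact ⟨C + D, fun j hj t => (abs_sub _ _).trans (add_le_add (hC j hj t) (hD j hj t))⟩

theorem Bdd.of_summable {f : ℤ → ℕ → ℝ} {b : ℕ → ℝ} (hb : Summable b)
    (hf : ∀ j ∈ Finset.Icc P.jLo P.jHi, ∀ t, |f j t| ≤ b t) : P.Bdd f := by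
  obtain ⟨C, hC⟩ := hb.tendsto_atTop_zero.bddAbove_range
  exact ⟨C, fun j hj t => (hf j hj t).trans (hC ⟨t, rfl⟩)⟩

theorem q_summable {m : ℤ → ℕ → ℝ} (hm : ∀ j, Summable (m j)) (j : ℤ) :
    Summable fun t => P.q m j (t + 1) :=
  (((hm (j - 1)).mul_left _).add ((hm (j + 1)).mul_left _)).sub
    ((summable_nat_add_iff 1).2 (hm j))

theorem value_summable {f m : ℤ → ℕ → ℝ} (hf : P.Bdd f) (hm : ∀ j, Summable (m j)) :
    Summable fun t => ∑ j ∈ Finset.Icc P.jLo P.jHi, f j (t + 1) * P.q m j (t + 1) := by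
  obtain ⟨C, hC⟩ := hf
  refine summable_sum fun j hj => ?_
  refine Summable.of_norm_bounded ((q_summable (P := P) hm j).abs.mul_left C) fun t => ?_
  rw [Real.norm_eq_abs, abs_mul]
  exact mul_le_mul_of_nonneg_right (hC j hj _) (abs_nonneg _)

theorem value_sub_left {f g m : ℤ → ℕ → ℝ} (hf : P.Bdd f) (hg : P.Bdd g)
    (hm : ∀ j, Summable (m j)) :
    P.value (fun j t => f j t - g j t) m = P.value f m - P.value g m := by
  unfold value
  rw [← (value_summable hf hm).tsum_sub (value_summable hg hm)]
  simp only [sub_mul, Finset.sum_sub_distrib]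

theorem value_add_sub {f m₁ m₂ m₃ : ℤ → ℕ → ℝ} (hf : P.Bdd f) (h₁ : ∀ j, Summable (m₁ j))
    (h₂ : ∀ j, Summable (m₂ j)) (h₃ : ∀ j, Summable (m₃ j)) :
    P.value f (fun j t => m₁ j t - m₂ j t + m₃ j t) =
      P.value f m₁ - P.value f m₂ + P.value f m₃ := by
  unfold value
  rw [← (value_summable hf h₁).tsum_sub (value_summable hf h₂),
    ← ((value_summable hf h₁).sub (value_summable hf h₂)).tsum_add (value_summable hf h₃)]
  refine tsum_congr fun t => ?_
  rw [← Finset.sum_sub_distrib, ← Finset.sum_add_distrib]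
  refine Finset.sum_congr rfl fun j _ => ?_
  simp only [q]
  ring

theorem value_mono {f g m : ℤ → ℕ → ℝ} (hf : P.Bdd f) (hg : P.Bdd g) (hm : ∀ j, Summable (m j))
    (hq : ∀ j t, 0 ≤ P.q m j (t + 1))
    (hfg : ∀ j ∈ Finset.Icc P.jLo P.jHi, ∀ t, 0 < P.q m j (t + 1) → f j (t + 1) ≤ g j (t + 1)) :
    P.value f m ≤ P.value g m := by
  refine (value_summable hf hm).tsum_le_tsum (fun t => Finset.sum_le_sum fun j hj => ?_)
    (value_summable hg hm)
  rcases (hq j t).eq_or_lt with h | h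
  · simp [← h]
  · exact mul_le_mul_of_nonneg_right (hfg j hj t h) h.le

theorem eq_zero_of_value_nonpos {f m : ℤ → ℕ → ℝ} (hf : P.Bdd f) (hm : ∀ j, Summable (m j))
    (hq : ∀ j t, 0 ≤ P.q m j (t + 1)) (hf0 : ∀ j ∈ Finset.Icc P.jLo P.jHi, ∀ t, 0 ≤ f j t)
    (hv : P.value f m ≤ 0) {j : ℤ} (hj : j ∈ Finset.Icc P.jLo P.jHi) {t : ℕ}
    (hjt : 0 < P.q m j (t + 1)) : f j (t + 1) = 0 := by
  have h0 : ∀ t, ∀ j ∈ Finset.Icc P.jLo P.jHi, 0 ≤ f j (t + 1) * P.q m j (t + 1) :=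
    fun t j hj => mul_nonneg (hf0 j hj _) (hq j t)
  have h1 := (value_summable hf hm).le_tsum t fun t' _ => Finset.sum_nonneg (h0 t')
  have h2 := Finset.single_le_sum (h0 t) hj
  have h3 : f j (t + 1) * P.q m j (t + 1) = 0 := le_antisymm ((h2.trans h1).trans hv) (h0 t j hj)
  exact (mul_eq_zero.1 h3).resolve_right hjt.ne'

/-- The support of `G` avoids the end points, so a shift by at most one keeps it inside the interval
and both sides are sums over all of `ℤ`. -/
theorem sum_comp_add {a b d : ℤ} (hd : |d| ≤ 1) {G : ℤ → ℝ} (hG : ∀ j, j ∉ Set.Ioo a b → G j = 0) :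
    ∑ j ∈ Finset.Icc a b, G (j + d) = ∑ j ∈ Finset.Icc a b, G j := by
  rw [abs_le] at hd
  rw [← tsum_eq_sum (L := .unconditional ℤ) (f := G) (s := Finset.Icc a b),
    ← tsum_eq_sum (L := .unconditional ℤ) (f := fun j => G (j + d))]
  · exact (Equiv.addRight d).tsum_eq G
  · intro j hj
    refine hG _ fun h => hj ?_
    rw [Set.mem_Ioo] at h
    rw [Finset.mem_Icc]
    omega
  · intro j hj
    refine hG _ fun h => hj ?_
    exact Finset.mem_Icc.2 ⟨h.1.le, h.2.le⟩

/-- Optional stopping: a payoff that is a bounded martingale has the value it starts from. -/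
theorem value_of_harmonic {f m : ℤ → ℕ → ℝ} (hf : P.Bdd f) (hm : ∀ j, Summable (m j))
    (h0 : ∀ j, j ∉ Set.Ioo P.jLo P.jHi → ∀ t, m j t = 0)
    (hh : ∀ j t, f j t = P.up * f (j + 1) (t + 1) + (1 - P.up) * f (j - 1) (t + 1)) :
    P.value f m = ∑ j ∈ Finset.Icc P.jLo P.jHi, f j 0 * m j 0 := by
  set A : ℕ → ℝ := fun t => ∑ j ∈ Finset.Icc P.jLo P.jHi, f j t * m j t with hA
  have hstep : ∀ t, ∑ j ∈ Finset.Icc P.jLo P.jHi, f j (t + 1) * P.q m j (t + 1) =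
      A t - A (t + 1) := by
    intro t
    have e1 := sum_comp_add (d := -1) (by simp) (G := fun j => P.up * f (j + 1) (t + 1) * m j t)
      (a := P.jLo) (b := P.jHi) (fun j hj => by simp [h0 j hj])
    have e2 := sum_comp_add (d := 1) (by simp)
      (G := fun j => (1 - P.up) * f (j - 1) (t + 1) * m j t)
      (a := P.jLo) (b := P.jHi) (fun j hj => by simp [h0 j hj])
    have e3 : A t = ∑ j ∈ Finset.Icc P.jLo P.jHi, P.up * f (j + 1) (t + 1) * m j t +
        ∑ j ∈ Finset.Icc P.jLo P.jHi, (1 - P.up) * f (j - 1) (t + 1) * m j t := by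
      rw [← Finset.sum_add_distrib]
      refine Finset.sum_congr rfl fun j _ => ?_
      rw [hh j t]
      ring
    rw [e3, ← e1, ← e2, ← Finset.sum_add_distrib, hA, ← Finset.sum_sub_distrib]
    refine Finset.sum_congr rfl fun j _ => ?_
    simp only [q, sub_add_cancel, add_sub_cancel_right, ← sub_eq_add_neg]
    ring
  have hlim : Tendsto A atTop (𝓝 0) := by
    obtain ⟨C, hC⟩ := hf
    have : Summable A := by
      refine summable_sum fun j hj => ?_
      refine Summable.of_norm_bounded ((hm j).abs.mul_left C) fun t => ?_
      rw [Real.norm_eq_abs, abs_mul]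
      exact mul_le_mul_of_nonneg_right (hC j hj _) (abs_nonneg _)
    exact this.tendsto_atTop_zero
  have h1 := (value_summable hf hm).hasSum.tendsto_sum_nat
  simp only [hstep, Finset.sum_range_sub'] at h1
  have h2 := tendsto_nhds_unique h1 (hlim.const_sub (A 0))
  rw [sub_zero] at h2
  simp only [value, hstep]
  exact h2

/-! ### Delayed flows. -/

/-- The flow `m` started at time `s` instead of `0`. -/
def delay (s : ℕ) (m : ℤ → ℕ → ℝ) (j : ℤ) (u : ℕ) : ℝ := if s ≤ u then m j (u - s) else 0

theorem delay_add (s : ℕ) (m : ℤ → ℕ → ℝ) (j : ℤ) (u : ℕ) : delay s m j (u + s) = m j u := by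
  simp [delay]

theorem delay_of_lt {s u : ℕ} (h : u < s) (m : ℤ → ℕ → ℝ) (j : ℤ) : delay s m j u = 0 :=
  if_neg h.not_ge

theorem hasSum_delay (s : ℕ) {m : ℤ → ℕ → ℝ} {j : ℤ} (hm : Summable (m j)) :
    HasSum (delay s m j) (∑' t, m j t) := by
  rw [← hasSum_nat_add_iff' s]
  simp only [delay_add]
  rw [Finset.sum_eq_zero fun u hu => delay_of_lt (Finset.mem_range.1 hu) m j, sub_zero]
  exact hm.hasSum

theorem q_delay_add (s : ℕ) (m : ℤ → ℕ → ℝ) (j : ℤ) (u : ℕ) :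
    P.q (delay s m) j (u + s + 1) = P.q m j (u + 1) := by
  simp only [q, delay_add]
  rw [show u + s + 1 = (u + 1) + s by ring, delay_add]

/-- Nothing flows into time `s`, so the injected mass appears as negative stopped mass. At `s = 0`
this fails, `q` being zero there by convention. -/
theorem q_delay_self {s : ℕ} (hs : 0 < s) (m : ℤ → ℕ → ℝ) (j : ℤ) :
    P.q (delay s m) j s = - m j 0 := by
  obtain ⟨a, rfl⟩ := Nat.exists_eq_succ_of_ne_zero hs.ne'
  have := delay_add (a + 1) m j 0
  rw [zero_add] at this
  simp [q, delay_of_lt (Nat.lt_succ_self a), this]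

theorem q_delay_of_lt {s u : ℕ} (h : u < s) (m : ℤ → ℕ → ℝ) (j : ℤ) :
    P.q (delay s m) j u = 0 := by
  cases u with
  | zero => rfl
  | succ u => simp [q, delay_of_lt h, delay_of_lt (show u < s by omega)]

theorem value_delay {f m : ℤ → ℕ → ℝ} (hf : P.Bdd f) (hm : ∀ j, Summable (m j)) {s : ℕ}
    (hs : 0 < s) : P.value f (delay s m) =
      P.value (fun j r => f j (s + r)) m - ∑ j ∈ Finset.Icc P.jLo P.jHi, f j s * m j 0 := by
  obtain ⟨a, rfl⟩ := Nat.exists_eq_succ_of_ne_zero hs.ne'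
  unfold value
  rw [← (value_summable hf fun j => (hasSum_delay _ (hm j)).summable).sum_add_tsum_nat_add (a + 1),
    Finset.sum_range_succ, Finset.sum_eq_zero, zero_add, add_comm, sub_eq_add_neg,
    ← Finset.sum_neg_distrib]
  · congr 1
    · refine tsum_congr fun t => Finset.sum_congr rfl fun j _ => ?_
      rw [q_delay_add]
      congr 2
      simp only [Nat.succ_eq_add_one]
      ring
    · refine Finset.sum_congr rfl fun j _ => ?_
      rw [q_delay_self hs]
      simp
  · intro t ht
    refine Finset.sum_eq_zero fun j _ => ?_
    rw [q_delay_of_lt (by have := Finset.mem_range.1 ht; simp only [Nat.succ_eq_add_one]; omega),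
      mul_zero]

/-! ### Subflows and the exchange. -/

theorem Feasible.summable_row {p : ℤ → ℕ → ℝ} (hp : P.Feasible p) (j : ℤ) : Summable (p j) :=
  hp.summable.prod_factor j

theorem Feasible.q_nonneg {p : ℤ → ℕ → ℝ} (hp : P.Feasible p) (j : ℤ) (t : ℕ) : 0 ≤ P.q p j t := by
  by_cases hj : j ∈ Set.Ioo P.jLo P.jHi
  · exact hp.stopped_nonneg j hj t
  · cases t with
    | zero => exact le_rfl
    | succ t =>
      rw [q, hp.absorbed j hj, sub_zero]
      exact add_nonneg (mul_nonneg P.up_pos.le (hp.nonneg _ _))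
        (mul_nonneg (sub_nonneg.2 P.up_lt_one.le) (hp.nonneg _ _))

theorem summable_of_rows {p : ℤ → ℕ → ℝ} (hp : ∀ j t, 0 ≤ p j t)
    (h0 : ∀ j, j ∉ Set.Ioo P.jLo P.jHi → ∀ t, p j t = 0) (hs : ∀ j, Summable (p j)) :
    Summable fun z : ℤ × ℕ => p z.1 z.2 := by
  refine (summable_prod_of_nonneg fun z => hp z.1 z.2).2 ⟨hs, ?_⟩
  refine summable_of_ne_finset_zero (s := Finset.Ioo P.jLo P.jHi) fun j hj => ?_
  simp [h0 j (by simpa using hj)]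

/-- The part of the flow `p` that comes from a proportion `θ` of the mass continuing from
`(i, s)`, with time measured from `s`. -/
noncomputable def subflow (P : Problem) (p : ℤ → ℕ → ℝ) (i : ℤ) (s : ℕ) (θ : ℝ) : ℕ → ℤ → ℝ
  | 0 => fun j => if j = i then θ * p i s else 0
  | r + 1 => fun j =>
      p j (s + r + 1) / (P.up * p (j - 1) (s + r) + (1 - P.up) * p (j + 1) (s + r)) *
        (P.up * P.subflow p i s θ r (j - 1) + (1 - P.up) * P.subflow p i s θ r (j + 1))

/-- One step of a subflow: of the inflow `I`, the part `a` continues, and the subflow's inflow `m`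
is split in the same ratio. If `I = 0`, everything vanishes and the convention `a / 0 = 0` is
harmless. -/
theorem thinned_bounds {a I m θ : ℝ} (ha : 0 ≤ a) (haI : a ≤ I) (hm : 0 ≤ m) (hmI : m ≤ θ * I) :
    0 ≤ a / I * m ∧ a / I * m ≤ θ * a ∧ 0 ≤ m - a / I * m ∧ m - a / I * m ≤ θ * (I - a) := by
  rcases (ha.trans haI).eq_or_lt with h | h
  · subst h
    have : a = 0 := le_antisymm haI ha
    subst this
    have : m = 0 := le_antisymm (by simpa using hmI) hm
    simp [this]
  · have h1 : 0 ≤ a / I := by positivity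
    have h2 : 0 ≤ 1 - a / I := sub_nonneg.2 ((div_le_one h).2 haI)
    have h3 : a / I * I = a := by field_simp
    refine ⟨mul_nonneg h1 hm, ?_, ?_, ?_⟩
    · linarith [mul_le_mul_of_nonneg_left hmI h1, show a / I * (θ * I) = θ * (a / I * I) by ring,
        congrArg (θ * ·) h3]
    · linarith [mul_nonneg h2 hm]
    · linarith [mul_le_mul_of_nonneg_left hmI h2,
        show (1 - a / I) * (θ * I) = θ * (I - a / I * I) by ring,
        congrArg (fun y => θ * (I - y)) h3]

theorem Feasible.exists_subflow {p : ℤ → ℕ → ℝ} (hp : P.Feasible p) (i : ℤ) (s : ℕ) {θ : ℝ}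
    (hθ : 0 ≤ θ) : ∃ m : ℤ → ℕ → ℝ, (∀ j, m j 0 = if j = i then θ * p i s else 0) ∧
      (∀ j r, 0 ≤ m j r) ∧ (∀ j r, m j r ≤ θ * p j (s + r)) ∧
      (∀ j r, 0 ≤ P.q m j (r + 1)) ∧ (∀ j r, P.q m j (r + 1) ≤ θ * P.q p j (s + r + 1)) := by
  have hup := P.up_pos.le
  have hup' := sub_nonneg.2 P.up_lt_one.le
  have key : ∀ r, (∀ j, 0 ≤ P.subflow p i s θ r j ∧ P.subflow p i s θ r j ≤ θ * p j (s + r)) →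
      ∀ j, _ := fun r ih j =>
    thinned_bounds (hp.nonneg j (s + r + 1)) (sub_nonneg.1 (hp.q_nonneg j (s + r + 1)))
      (add_nonneg (mul_nonneg hup (ih (j - 1)).1) (mul_nonneg hup' (ih (j + 1)).1))
      (θ := θ) (by linarith [mul_le_mul_of_nonneg_left (ih (j - 1)).2 hup,
        mul_le_mul_of_nonneg_left (ih (j + 1)).2 hup'])
  have bounds : ∀ r j, 0 ≤ P.subflow p i s θ r j ∧ P.subflow p i s θ r j ≤ θ * p j (s + r) := by
    intro r
    induction r with
    | zero =>
      intro j
      have := mul_nonneg hθ (hp.nonneg j s)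
      by_cases h : j = i
      · subst h
        simpa [subflow] using this
      · simpa [subflow, h] using this
    | succ r ih => exact fun j => ⟨(key r ih j).1, (key r ih j).2.1⟩
  exact ⟨fun j r => P.subflow p i s θ r j, fun j => rfl, fun j r => (bounds r j).1,
    fun j r => (bounds r j).2, fun j r => (key r (bounds r) j).2.2.1,
    fun j r => (key r (bounds r) j).2.2.2⟩

/-- If mass is stopped at `(i, t)` while mass continues from `(i, s)`, then a small amount of each
can exchange roles: the paths that continued from `(i, s)` stop there, and the ones that stopped
at `(i, t)` follow the continuation instead. -/
theorem Feasible.exchange {p : ℤ → ℕ → ℝ} (hp : P.Feasible p) {i : ℤ}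
    (hi : i ∈ Set.Icc P.jLo P.jHi) {s t : ℕ} (hs : 0 < s) (ht : 0 < t) (hps : 0 < p i s)
    (hqt : 0 < P.q p i t) :
    ∃ (m p' : ℤ → ℕ → ℝ) (ε : ℝ), 0 < ε ∧ (∀ j, m j 0 = if j = i then ε else 0) ∧
      (∀ j, Summable (m j)) ∧ (∀ j, j ∉ Set.Ioo P.jLo P.jHi → ∀ r, m j r = 0) ∧
      (∀ j r, 0 ≤ P.q m j (r + 1)) ∧ P.Feasible p' ∧
      ∀ f, P.Bdd f → P.value f p' = P.value f p +
        (P.value (fun j r => f j (t + r) - f j (s + r)) m - ε * (f i t - f i s)) := by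
  -- Removing the old subflow and inserting the new one may both consume stopped mass at the same
  -- point, so each is allowed half of it.
  set θ := min (1 / 2) (P.q p i t / (2 * p i s)) with hθ
  have hθ0 : 0 < θ := lt_min (by norm_num) (by positivity)
  have hθ1 : θ ≤ 1 / 2 := min_le_left _ _
  have hθ2 : θ * p i s ≤ P.q p i t / 2 := by
    have : θ ≤ P.q p i t / (2 * p i s) := min_le_right _ _
    calc θ * p i s ≤ P.q p i t / (2 * p i s) * p i s := mul_le_mul_of_nonneg_right this hps.le
      _ = P.q p i t / 2 := by field_simp
  obtain ⟨m, hm0, hm1, hm2, hm3, hm4⟩ := hp.exists_subflow i s hθ0.le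
  have hsum : ∀ j, Summable (m j) := fun j =>
    Summable.of_nonneg_of_le (hm1 j) (hm2 j)
      ((((summable_nat_add_iff s).2 (hp.summable_row j)).congr
        fun r => by rw [add_comm]).mul_left θ)
  have habs : ∀ j, j ∉ Set.Ioo P.jLo P.jHi → ∀ r, m j r = 0 := fun j hj r =>
    le_antisymm (by simpa [hp.absorbed j hj] using hm2 j r) (hm1 j r)
  have hds := fun j => hasSum_delay s (hsum j)
  have hdt := fun j => hasSum_delay t (hsum j)
  have hnt : ∀ j u, 0 ≤ delay t m j u := by
    intro j u
    unfold delay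
    split
    exacts [hm1 _ _, le_rfl]
  have hns : ∀ j u, delay s m j u ≤ p j u := by
    intro j u
    have h0 := hp.nonneg j u
    unfold delay
    split
    · rename_i hsu
      have := hm2 j (u - s)
      rw [Nat.add_sub_cancel' hsu] at this
      nlinarith
    · exact h0
  have hqs : ∀ j u, P.q (delay s m) j u ≤ P.q p j u / 2 := by
    intro j u
    have h0 := hp.q_nonneg j u
    rcases lt_trichotomy u s with h | h | h
    · rw [q_delay_of_lt h]
      linarith
    · subst h
      rw [q_delay_self hs]
      linarith [hm1 j 0]
    · obtain ⟨r, rfl⟩ := Nat.exists_eq_add_of_lt h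
      rw [show s + r + 1 = r + s + 1 by ring, q_delay_add, show r + s + 1 = s + r + 1 by ring]
      nlinarith [hm4 j r]
  have hqt' : ∀ j u, -(P.q p j u / 2) ≤ P.q (delay t m) j u := by
    intro j u
    have h0 := hp.q_nonneg j u
    rcases lt_trichotomy u t with h | h | h
    · rw [q_delay_of_lt h]
      linarith
    · subst h
      rw [q_delay_self ht, hm0]
      split
      · rename_i hji
        subst hji
        linarith
      · linarith
    · obtain ⟨r, rfl⟩ := Nat.exists_eq_add_of_lt h
      rw [show t + r + 1 = r + t + 1 by ring, q_delay_add, show r + t + 1 = t + r + 1 by ring]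
      linarith [hm3 j r]
  -- Both delayed copies have the same sum over time, so they cancel.
  have hp'sum : ∀ j, HasSum (fun u => p j u - delay s m j u + delay t m j u) (∑' u, p j u) := by
    intro j
    have := ((hp.summable_row j).hasSum.sub (hds j)).add (hdt j)
    rwa [sub_add_cancel] at this
  have hnn : ∀ j u, 0 ≤ p j u - delay s m j u + delay t m j u := fun j u => by
    linarith [hns j u, hnt j u]
  have habs' : ∀ j, j ∉ Set.Ioo P.jLo P.jHi → ∀ u,
      p j u - delay s m j u + delay t m j u = 0 := fun j hj u => by
    simp [hp.absorbed j hj, delay, habs j hj]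
  refine ⟨m, fun j u => p j u - delay s m j u + delay t m j u, θ * p i s, mul_pos hθ0 hps, hm0,
    hsum, habs, hm3, ⟨fun j => ?_, habs', ?_, hnn, fun j hj => ?_, fun j _ u => ?_⟩,
    fun f hf => ?_⟩
  · simp [delay_of_lt hs, delay_of_lt ht, hp.init]
  · exact summable_of_rows hnn habs' fun j => (hp'sum j).summable
  · rw [(hp'sum j).tsum_eq]
    exact hp.local_time j hj
  · have : P.q (fun j u => p j u - delay s m j u + delay t m j u) j u =
        P.q p j u - P.q (delay s m) j u + P.q (delay t m) j u := by
      cases u with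
      | zero => simp [q]
      | succ u =>
        simp only [q]
        ring
    rw [this]
    linarith [hqs j u, hqt' j u]
  · have h0 : ∀ u, ∑ j ∈ Finset.Icc P.jLo P.jHi, f j u * m j 0 = f i u * (θ * p i s) := by
      intro u
      rw [Finset.sum_eq_single_of_mem i (Finset.mem_Icc.2 hi)]
      · rw [hm0, if_pos rfl]
      · intro j _ hj
        rw [hm0, if_neg hj, mul_zero]
    rw [value_add_sub hf hp.summable_row (fun j => (hds j).summable) (fun j => (hdt j).summable),
      value_delay hf hsum hs, value_delay hf hsum ht, h0, h0,
      value_sub_left (hf.comp_add t) (hf.comp_add s) hsum]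
    ring

/-- Let `p` maximise the value of `f`, and among the maximisers the value of `g`. If an exchange
cannot decrease the value of `f`, because its gain is bounded below by a martingale `c`, then it
cannot increase that of `g`. -/
theorem Feasible.gain_le_of_lexMax {p f g : ℤ → ℕ → ℝ} (hp : P.Feasible p)
    (hf : P.Bdd f) (hg : P.Bdd g) (hmax : ∀ p', P.Feasible p' → P.value f p' ≤ P.value f p)
    (hmax' : ∀ p', P.Feasible p' → P.value f p' = P.value f p → P.value g p' ≤ P.value g p)
    {i : ℤ} (hi : i ∈ Set.Icc P.jLo P.jHi) {s t : ℕ} (hs : 0 < s) (ht : 0 < t)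
    (hps : 0 < p i s) (hqt : 0 < P.q p i t) {c : ℤ → ℕ → ℝ} (hc : P.Bdd c)
    (hch : ∀ j r, c j r = P.up * c (j + 1) (r + 1) + (1 - P.up) * c (j - 1) (r + 1))
    (hcf : ∀ j r, c j r ≤ f j (t + r) - f j (s + r)) (hci : c i 0 = f i t - f i s) {d : ℝ}
    (hd : ∀ j r, c j (r + 1) = f j (t + (r + 1)) - f j (s + (r + 1)) →
      d ≤ g j (t + (r + 1)) - g j (s + (r + 1))) :
    d ≤ g i t - g i s := by
  obtain ⟨m, p', ε, hε, hm0, hm, hmabs, hqm, hp', hval⟩ := hp.exchange hi hs ht hps hqt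
  have hΦ := (hf.comp_add t).sub (hf.comp_add s)
  have harm : ∀ e : ℤ → ℕ → ℝ, P.Bdd e →
      (∀ j r, e j r = P.up * e (j + 1) (r + 1) + (1 - P.up) * e (j - 1) (r + 1)) →
      P.value e m = ε * e i 0 := by
    intro e he heh
    rw [value_of_harmonic he hm hmabs heh, Finset.sum_eq_single_of_mem i (Finset.mem_Icc.2 hi)]
    · rw [hm0, if_pos rfl, mul_comm]
    · intro j _ hj
      rw [hm0, if_neg hj, mul_zero]
  have hcv := harm c hc hch
  have hvf := hval f hf
  have hdiff := value_sub_left hΦ hc hm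
  rw [← hci, ← hcv, ← hdiff] at hvf
  -- The value on the left is exactly the gain in `f`; its integrand is nonnegative, so it vanishes
  -- wherever `m` stops.
  have hle : P.value (fun j r => f j (t + r) - f j (s + r) - c j r) m ≤ 0 := by
    linarith [hmax p' hp']
  have hzero := fun (j : ℤ) (hj : j ∈ Finset.Icc P.jLo P.jHi) (r : ℕ) =>
    eq_zero_of_value_nonpos (hΦ.sub hc) hm hqm (fun j _ r => sub_nonneg.2 (hcf j r)) hle hj (t := r)
  have hge : 0 ≤ P.value (fun j r => f j (t + r) - f j (s + r) - c j r) m :=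
    tsum_nonneg fun r => Finset.sum_nonneg fun j _ =>
      mul_nonneg (sub_nonneg.2 (hcf j (r + 1))) (hqm j r)
  have hg' := hmax' p' hp' (by linarith)
  have hdB : P.Bdd fun _ _ => d := ⟨|d|, fun _ _ _ => le_rfl⟩
  have hmono := value_mono hdB ((hg.comp_add t).sub (hg.comp_add s)) hm hqm fun j hj r hr =>
    hd j r (sub_eq_zero.1 (hzero j hj r hr)).symm
  -- A constant is a martingale: the total mass stopped by `m` is `ε`.
  rw [harm (fun _ _ => d) hdB (fun _ _ => by ring)] at hmono
  rw [hval g hg] at hg'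
  exact le_of_mul_le_mul_left (by linarith) hε

/-! ### Compactness and lexicographic maximisers. -/

/-- Partial sums turn the local time bound into conditions closed under pointwise convergence; they
also imply summability. -/
theorem feasible_iff (p : ℤ → ℕ → ℝ) : P.Feasible p ↔
    (∀ j, p j 0 = if j = P.jStar then 1 else 0) ∧
    (∀ j, j ∉ Set.Ioo P.jLo P.jHi → ∀ t, p j t = 0) ∧ (∀ j t, 0 ≤ p j t) ∧
    (∀ j ∈ Set.Ioo P.jLo P.jHi, ∀ n, ∑ t ∈ Finset.range n, p j t ≤ P.U j) ∧
    ∀ j ∈ Set.Ioo P.jLo P.jHi, ∀ t, 0 ≤ P.q p j t := by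
  constructor
  · intro hp
    exact ⟨hp.init, hp.absorbed, hp.nonneg, fun j hj n =>
      ((hp.summable_row j).sum_le_tsum _ fun t _ => hp.nonneg j t).trans (hp.local_time j hj),
      hp.stopped_nonneg⟩
  · rintro ⟨h1, h2, h3, h4, h5⟩
    refine ⟨h1, h2, summable_of_rows h3 h2 fun j => ?_, h3, fun j hj =>
      Real.tsum_le_of_sum_range_le (h3 j) (h4 j hj), h5⟩
    by_cases hj : j ∈ Set.Ioo P.jLo P.jHi
    · exact summable_of_sum_range_le (h3 j) (h4 j hj)
    · simpa only [funext (h2 j hj)] using summable_zero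

theorem continuous_q (j : ℤ) (t : ℕ) : Continuous fun p : ℤ → ℕ → ℝ => P.q p j t := by
  cases t with
  | zero => exact continuous_const
  | succ t =>
    simp only [q]
    fun_prop

theorem isClosed_feasible : IsClosed {p | P.Feasible p} := by
  simp only [feasible_iff, Set.ofPred_and, Set.ofPred_forall]
  have hev : ∀ (j : ℤ) (t : ℕ), Continuous fun p : ℤ → ℕ → ℝ => p j t := fun j t => by fun_prop
  refine .inter ?_ (.inter ?_ (.inter ?_ (.inter ?_ ?_)))
  · exact isClosed_iInter fun j => isClosed_eq (hev j 0) continuous_const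
  · exact isClosed_iInter fun j => isClosed_iInter fun _ => isClosed_iInter fun t =>
      isClosed_eq (hev j t) continuous_const
  · exact isClosed_iInter fun j => isClosed_iInter fun t => isClosed_le continuous_const (hev j t)
  · exact isClosed_iInter fun j => isClosed_iInter fun _ => isClosed_iInter fun n =>
      isClosed_le (continuous_finsetSum _ fun t _ => hev j t) continuous_const
  · exact isClosed_iInter fun j => isClosed_iInter fun _ => isClosed_iInter fun t =>
      isClosed_le continuous_const (continuous_q j t)

theorem Feasible.le_max {p : ℤ → ℕ → ℝ} (hp : P.Feasible p) (j : ℤ) (t : ℕ) :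
    p j t ≤ max (P.U j) 0 := by
  by_cases hj : j ∈ Set.Ioo P.jLo P.jHi
  · exact (((hp.summable_row j).le_tsum t fun u _ => hp.nonneg j u).trans
      (hp.local_time j hj)).trans (le_max_left _ _)
  · rw [hp.absorbed j hj]
    exact le_max_right _ _

theorem isCompact_feasible : IsCompact {p | P.Feasible p} := by
  refine (isCompact_univ_pi fun j : ℤ => isCompact_univ_pi fun _ : ℕ =>
    isCompact_Icc (a := (0 : ℝ)) (b := max (P.U j) 0)).of_isClosed_subset isClosed_feasible ?_
  exact fun p hp j _ t _ => ⟨hp.nonneg j t, hp.le_max j t⟩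

/-- The summable bound gives uniform convergence on the feasible set, by the Weierstrass test. -/
theorem continuousOn_value {f : ℤ → ℕ → ℝ} {b : ℕ → ℝ} (hb : Summable b)
    (hf : ∀ j ∈ Finset.Icc P.jLo P.jHi, ∀ t, |f j t| ≤ b t) :
    ContinuousOn (P.value f) {p | P.Feasible p} := by
  refine continuousOn_tsum (u := fun t => ∑ j ∈ Finset.Icc P.jLo P.jHi,
    b (t + 1) * (max (P.U (j - 1)) 0 + max (P.U (j + 1)) 0)) (fun t => ?_) ?_ ?_
  · exact (continuous_finsetSum _ fun j _ =>
      continuous_const.mul (continuous_q j (t + 1))).continuousOn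
  · exact summable_sum fun j _ => ((summable_nat_add_iff 1).2 hb).mul_right _
  · intro t p hp
    refine (norm_sum_le _ _).trans (Finset.sum_le_sum fun j hj => ?_)
    have hq : P.q p j (t + 1) ≤ max (P.U (j - 1)) 0 + max (P.U (j + 1)) 0 := by
      have h1 := hp.le_max (j - 1) t
      have h2 := hp.le_max (j + 1) t
      have h3 := hp.nonneg j (t + 1)
      have h4 := hp.nonneg (j - 1) t
      have h5 := hp.nonneg (j + 1) t
      have h6 := P.up_pos
      have h7 := P.up_lt_one
      simp only [q]
      nlinarith
    rw [Real.norm_eq_abs, abs_mul, abs_of_nonneg (hp.q_nonneg j (t + 1))]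
    exact mul_le_mul (hf j hj _) hq (hp.q_nonneg j (t + 1)) ((abs_nonneg _).trans (hf j hj _))

theorem exists_lexMax {f g : ℤ → ℕ → ℝ} (hf : ContinuousOn (P.value f) {p | P.Feasible p})
    (hg : ContinuousOn (P.value g) {p | P.Feasible p}) (hne : ∃ p, P.Feasible p) :
    ∃ p, P.Feasible p ∧ (∀ p', P.Feasible p' → P.value f p' ≤ P.value f p) ∧
      ∀ p', P.Feasible p' → P.value f p' = P.value f p → P.value g p' ≤ P.value g p := by
  obtain ⟨p₀, hp₀, hmax⟩ := isCompact_feasible.exists_isMaxOn hne hf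
  have hK : IsCompact ({p | P.Feasible p} ∩ P.value f ⁻¹' {P.value f p₀}) :=
    isCompact_feasible.of_isClosed_subset
      (hf.preimage_isClosed_of_isClosed isClosed_feasible isClosed_singleton) Set.inter_subset_left
  obtain ⟨p, hp, hmax'⟩ := hK.exists_isMaxOn ⟨p₀, hp₀, rfl⟩ (hg.mono Set.inter_subset_left)
  have hpf : P.value f p = P.value f p₀ := hp.2
  refine ⟨p, hp.1, fun p' hp' => ?_, fun p' hp' h => hmax' ⟨hp', h.trans hpf⟩⟩
  rw [hpf]
  exact hmax hp'

/-! ### The secondary objective and bounds on the payoffs. -/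

/-- Weight of the secondary objective that selects a cave solution among the optimal ones. -/
noncomputable def tieBreak (P : Problem) (j : ℤ) (t : ℕ) : ℝ :=
  if P.k ≤ P.h j t then (t : ℝ) ^ 2 else -(1 / 2) ^ t

theorem neg_half_pow_le_tieBreak (P : Problem) (j : ℤ) (t : ℕ) :
    -(1 / 2) ^ t ≤ P.tieBreak j t := by
  unfold tieBreak
  split
  · have : (0 : ℝ) ≤ (1 / 2) ^ t := by positivity
    nlinarith [sq_nonneg (t : ℝ)]
  · exact le_rfl

theorem summable_growth_inv_pow (hP : P.Admissible) : Summable fun t : ℕ => P.growth⁻¹ ^ t := by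
  have := one_lt_growth hP
  exact summable_geometric_of_lt_one (by positivity) (inv_lt_one_of_one_lt₀ this)

theorem h_le (hP : P.Admissible) {j : ℤ} (hj : j ∈ Finset.Icc P.jLo P.jHi) (t : ℕ) :
    P.h j t ≤ (∑ j ∈ Finset.Icc P.jLo P.jHi, P.hInit j) * P.growth⁻¹ ^ t := by
  have := one_lt_growth hP
  rw [h_natCast hP]
  exact mul_le_mul_of_nonneg_right
    (Finset.single_le_sum (fun j _ => (P.hInit_pos j).le) hj) (by positivity)

theorem exists_bound_h (hP : P.Admissible) : ∃ b : ℕ → ℝ, Summable b ∧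
    ∀ j ∈ Finset.Icc P.jLo P.jHi, ∀ t : ℕ, |P.h j t| ≤ b t := by
  refine ⟨_, (summable_growth_inv_pow hP).mul_left (∑ j ∈ Finset.Icc P.jLo P.jHi, P.hInit j), fun j hj t => ?_⟩
  rw [abs_of_pos (h_pos hP j t)]
  exact h_le hP hj t

theorem exists_bound_F (hP : P.Admissible) : ∃ b : ℕ → ℝ, Summable b ∧
    ∀ j ∈ Finset.Icc P.jLo P.jHi, ∀ t, |P.F j t| ≤ b t := by
  obtain ⟨b, hb, hh⟩ := exists_bound_h hP
  refine ⟨b, hb, fun j hj t => le_trans ?_ (hh j hj t)⟩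
  rw [F, abs_of_nonneg (le_max_right _ _)]
  exact max_le ((sub_le_self _ hP.strike_pos.le).trans (le_abs_self _)) (abs_nonneg _)

theorem exists_bound_tieBreak (hP : P.Admissible) : ∃ b : ℕ → ℝ, Summable b ∧
    ∀ j ∈ Finset.Icc P.jLo P.jHi, ∀ t, |P.tieBreak j t| ≤ b t := by
  have hg := one_lt_growth hP
  have hk := hP.strike_pos
  set H := ∑ j ∈ Finset.Icc P.jLo P.jHi, P.hInit j with hH
  have hH0 : 0 ≤ H := Finset.sum_nonneg fun j _ => (P.hInit_pos j).le
  have hs : Summable fun t : ℕ => (t : ℝ) ^ 2 * P.growth⁻¹ ^ t :=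
    summable_pow_mul_geometric_of_norm_lt_one 2 (by
      rw [Real.norm_eq_abs, abs_of_pos (by positivity)]
      exact inv_lt_one_of_one_lt₀ hg)
  refine ⟨fun t => H / P.k * ((t : ℝ) ^ 2 * P.growth⁻¹ ^ t) + (1 / 2) ^ t,
    (hs.mul_left _).add summable_geometric_two, fun j hj t => ?_⟩
  have h2 : (0 : ℝ) ≤ (1 / 2) ^ t := by positivity
  unfold tieBreak
  split
  · rename_i hkh
    -- The square occurs only while `h` is at least `k`, so it can be multiplied by this geometric
    -- factor.
    have h1 : 1 ≤ H / P.k * P.growth⁻¹ ^ t := by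
      rw [div_mul_eq_mul_div, one_le_div hk]
      exact hkh.trans (h_le hP hj t)
    rw [abs_of_nonneg (sq_nonneg _)]
    nlinarith [mul_le_mul_of_nonneg_right h1 (sq_nonneg (t : ℝ))]
  · rw [abs_neg, abs_of_nonneg h2]
    exact le_add_of_nonneg_left (by positivity)

end LETF.Problem

theorem mainTheorem3 (P : LETF.Problem) (hP : P.Admissible) (hfeas : ∃ p, P.Feasible p) :
    ∃ p : ℤ → ℕ → ℝ, P.Optimal p ∧
      (∀ i ∈ Set.Icc P.jLo P.jHi, ∀ t : ℕ, 1 ≤ t → 0 < P.q p i t → (t : ℝ) < P.K i →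
        ∀ s : ℕ, 1 ≤ s → s < t → p i s = 0) ∧
      (∀ i ∈ Set.Icc P.jLo P.jHi, ∀ t : ℕ, 1 ≤ t → 0 < P.q p i t → P.K i < (t : ℝ) →
        ∀ s : ℕ, t < s → p i s = 0) := by
  open LETF.Problem in
  obtain ⟨bh, hbh, hhb⟩ := exists_bound_h hP
  obtain ⟨bF, hbF, hFb⟩ := exists_bound_F hP
  obtain ⟨bG, hbG, hGb⟩ := exists_bound_tieBreak hP
  have hhB : P.Bdd fun j t => P.h j t := Bdd.of_summable hbh hhb
  have hFB : P.Bdd P.F := Bdd.of_summable hbF hFb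
  have hGB : P.Bdd P.tieBreak := Bdd.of_summable hbG hGb
  obtain ⟨p, hp, hmax, hmax'⟩ :=
    exists_lexMax (continuousOn_value hbF hFb) (continuousOn_value hbG hGb) hfeas
  refine ⟨p, ⟨hp, hmax⟩, fun i hi t ht hq hK s hs hst => ?_, fun i hi t ht hq hK s hst => ?_⟩
  · by_contra hne
    have hps : 0 < p i s := (hp.nonneg i s).lt_of_ne' hne
    have hkt := (lt_h_iff hP i t).2 hK
    have hks := hkt.trans (h_strictAnti hP i hst)
    have hanti : ∀ j r, P.h j (t + r : ℕ) < P.h j (s + r : ℕ) := fun j r =>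
      h_strictAnti hP j (Nat.add_lt_add_right hst r)
    have hst' : (s : ℝ) + 1 ≤ t := by exact_mod_cast hst
    have key := hp.gain_le_of_lexMax hFB hGB hmax hmax' hi hs ht hps hq
      (c := fun j r => P.h j (t + r : ℕ) - P.h j (s + r : ℕ))
      ((hhB.comp_add t).sub (hhB.comp_add s))
      (fun j r => by
        rw [h_harmonic hP j (t + r), h_harmonic hP j (s + r)]
        simp only [add_assoc]
        ring)
      (fun j r => by
        have := hanti j r
        simp only [F]
        rcases max_cases (P.h j (t + r : ℕ) - P.k) 0 with h1 | h1 <;>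
        rcases max_cases (P.h j (s + r : ℕ) - P.k) 0 with h2 | h2 <;> linarith)
      (by
        simp only [F, add_zero]
        rw [max_eq_left (by linarith), max_eq_left (by linarith)]
        ring)
      -- The difference of squares after one step, the least possible since the subflow stops no
      -- earlier; it exceeds the one at the start.
      (d := (t : ℝ) ^ 2 - (s : ℝ) ^ 2 + 2 * (t - s))
      (fun j r heq => by
        have hlt := hanti j (r + 1)
        -- Below `k` the later payoff is zero, and the Lipschitz bound would be strict.
        have hkt : P.k ≤ P.h j (t + (r + 1) : ℕ) := by
          by_contra! hcon
          simp only [F] at heq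
          rw [max_eq_right (by linarith)] at heq
          rcases max_cases (P.h j (s + (r + 1) : ℕ) - P.k) 0 with h2 | h2 <;> linarith
        rw [tieBreak, tieBreak, if_pos hkt, if_pos (hkt.trans hlt.le)]
        push_cast
        nlinarith [mul_nonneg (sub_nonneg.2 hst') (Nat.cast_nonneg (α := ℝ) r)])
    rw [tieBreak, tieBreak, if_pos hkt.le, if_pos hks.le] at key
    linarith
  · by_contra hne
    have hps : 0 < p i s := (hp.nonneg i s).lt_of_ne' hne
    have hkt := (h_lt_iff hP i t).2 hK
    have hks := (h_strictAnti hP i hst).trans hkt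
    have hanti : ∀ j r, P.h j (s + r : ℕ) < P.h j (t + r : ℕ) := fun j r =>
      h_strictAnti hP j (Nat.add_lt_add_right hst r)
    have hpow : (1 / 2 : ℝ) ^ s < (1 / 2) ^ t :=
      pow_lt_pow_right_of_lt_one₀ (by norm_num) (by norm_num) hst
    have key := hp.gain_le_of_lexMax hFB hGB hmax hmax' hi (by omega) ht hps hq
      (c := fun _ _ => 0) ⟨0, fun _ _ _ => by simp⟩ (fun _ _ => by ring)
      (fun j r => by
        simp only [F]
        exact sub_nonneg.2 (max_le_max_right _ (by linarith [hanti j r])))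
      (by
        simp only [F]
        rw [max_eq_right (by linarith), max_eq_right (by linarith), sub_zero])
      -- Half of the negative difference at the start: at least one step has been taken, and each
      -- step halves it.
      (d := ((1 / 2) ^ s - (1 / 2) ^ t) / 2)
      (fun j r heq => by
        have hlt := hanti j (r + 1)
        -- At or above `k` the two payoffs would differ, as `h` strictly decreases.
        have hks : P.h j (s + (r + 1) : ℕ) < P.k := by
          by_contra! hcon
          simp only [F] at heq
          rw [max_eq_left (by linarith), max_eq_left (by linarith)] at heq
          linarith
        rw [tieBreak.eq_1 P j (s + (r + 1)), if_neg hks.not_ge]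
        refine le_trans ?_ (sub_le_sub_right (neg_half_pow_le_tieBreak P j _) _)
        have hr : (1 / 2 : ℝ) ^ r ≤ 1 := pow_le_one₀ (by norm_num) (by norm_num)
        have hsplit : ∀ u : ℕ, (1 / 2 : ℝ) ^ (u + (r + 1)) = (1 / 2) ^ u * (1 / 2) ^ r / 2 :=
          fun u => by ring
        rw [hsplit, hsplit]
        nlinarith)
    rw [tieBreak, tieBreak, if_neg hkt.not_ge, if_neg hks.not_ge] at key
    linarith
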